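/- All vector spaces and algebras are finite-dimensional over $\mathbb{C}$. A (right) Leibniz algebra is a vector space $L$ with a bilinear bracket satisfying $[x,[y,z]]=[[x,y],z]-[[x,z],y]$. Let $I$ be the two-sided ideal of $L$ generated by all squares $[x,x]$, $x\in L$. Then $L/I$ is a Lie algebra, and $I$ is a right $L/I$-module via $i\cdot(x+I)=[i,x]$. **Theorem.** Let $L$ be a Leibniz algebra such that (a) $L/I\cong sl_2^1\oplus sl_2^2$, a direct sum of two copies of the Lie algebra $sl_2$; through this isomorphism $I$ is regarded as a right module over $sl_2^1$ and over $sl_2^2$; (b) $I=I_{1,1}\oplus I_{1,2}$, where $I_{1,1}$ and $I_{1,2}$ are irreducible right $sl_2^1$-submodules of $I$ with $\dim I_{1,1}=\dim I_{1,2}=m+1$. Then at least one of the following holds: (c) $I=I_{2,1}\oplus I_{2,2}\oplus\dots\oplus I_{2,m+1}$, where each $I_{2,k}$, $1\le k\le m+1$, is an irreducible right $sl_2^2$-submodule of $I$; (d) $L\cong (sl_2^1+I)\oplus sl_2^2$ as Leibniz algebras, where $sl_2^1+I$ is the vector space $sl_2^1\times I$ with bracket $[s+i,s'+i']=[s,s']+i\cdot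 s'$, and $\oplus$ is the direct sum of algebras. An irreducible module is a nonzero module whose only submodules are zero and itself. -/

import Mathlib

/-- A (right) Leibniz algebra over a field `K`: a `K`-vector space with a bilinear bracket that
satisfies the Leibniz identity `[x, [y, z]] = [[x, y], z] - [[x, z], y]`. -/
class LeibnizAlgebra (K L : Type*) [Field K] [AddCommGroup L] [Module K L] [Bracket L L] :
    Prop where
  add_bracket : ∀ x y z : L, ⁅x + y, z⁆ = ⁅x, z⁆ + ⁅y, z⁆
  bracket_add : ∀ x y z : L, ⁅x, y + z⁆ = ⁅x, y⁆ + ⁅x, z⁆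
  smul_bracket : ∀ (c : K) (x y : L), ⁅c • x, y⁆ = c • ⁅x, y⁆
  bracket_smul : ∀ (c : K) (x y : L), ⁅x, c • y⁆ = c • ⁅x, y⁆
  leibniz : ∀ x y z : L, ⁅x, ⁅y, z⁆⁆ = ⁅⁅x, y⁆, z⁆ - ⁅⁅x, z⁆, y⁆

namespace LeibnizAlgebra

/-- Every Lie algebra is a Leibniz algebra. -/
instance ofLieAlgebra (K G : Type*) [Field K] [LieRing G] [LieAlgebra K G] :
    LeibnizAlgebra K G where
  add_bracket := add_lie
  bracket_add := lie_add
  smul_bracket := smul_lie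
  bracket_smul := lie_smul
  leibniz x y z := by rw [leibniz_lie x y z, ← lie_skew y ⁅x, z⁆]; abel

section Quotient

variable (K L : Type*) [Field K] [AddCommGroup L] [Module K L] [Bracket L L]

/-- Two-sided ideals of an algebra with bracket. -/
def IsIdeal (J : Submodule K L) : Prop := ∀ x ∈ J, ∀ y : L, ⁅x, y⁆ ∈ J ∧ ⁅y, x⁆ ∈ J

/-- The ideal `I` generated by all squares `[x, x]`. -/
def sqIdeal : Submodule K L := sInf {J | IsIdeal K L J ∧ ∀ x : L, ⁅x, x⁆ ∈ J}

theorem isIdeal_sqIdeal : IsIdeal K L (sqIdeal K L) := by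
  intro x hx y
  simp only [sqIdeal, Submodule.mem_sInf, Set.mem_ofPred_eq] at hx ⊢
  exact ⟨fun J hJ => (hJ.1 x (hx J hJ) y).1, fun J hJ => (hJ.1 x (hx J hJ) y).2⟩

theorem sq_mem_sqIdeal (x : L) : ⁅x, x⁆ ∈ sqIdeal K L := by
  simp only [sqIdeal, Submodule.mem_sInf, Set.mem_ofPred_eq]
  exact fun J hJ => hJ.2 x

variable [LeibnizAlgebra K L]

/-- The bracket as a bilinear map. -/
def bracketHom : L →ₗ[K] L →ₗ[K] L :=
  LinearMap.mk₂ K (fun x y => ⁅x, y⁆) (add_bracket K) (smul_bracket (L := L))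
    (bracket_add K) (bracket_smul (L := L))

@[simp] theorem bracketHom_apply (x y : L) : bracketHom K L x y = ⁅x, y⁆ := rfl

theorem bracket_eq_zero_of_mem (x : L) {y : L} (hy : y ∈ sqIdeal K L) : ⁅x, y⁆ = 0 := by
  let Z : Submodule K L :=
    { carrier := {y | ∀ x : L, ⁅x, y⁆ = 0}
      add_mem' := fun {a b} ha hb x => by rw [bracket_add K, ha x, hb x, add_zero]
      zero_mem' := fun x => map_zero (bracketHom K L x)
      smul_mem' := fun c a ha x => by rw [bracket_smul c, ha x, smul_zero] }
  have h0 : ∀ z : L, ⁅(0 : L), z⁆ = 0 := fun z => by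
    rw [← bracketHom_apply K, map_zero, LinearMap.zero_apply]
  have hle : sqIdeal K L ≤ Z := by
    refine sInf_le ⟨fun a ha b => ⟨fun x => ?_, fun x => ?_⟩, fun a x => ?_⟩
    · rw [leibniz K, ha x, ha ⁅x, b⁆, h0, sub_zero]
    · rw [ha b]; exact map_zero (bracketHom K L x)
    · rw [leibniz K, sub_self]
  exact hle hy x

/-- The bracket of `L / I` as a bilinear map. -/
def quotientBracket : (L ⧸ sqIdeal K L) →ₗ[K] (L ⧸ sqIdeal K L) →ₗ[K] (L ⧸ sqIdeal K L) :=
  (sqIdeal K L).liftQ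
    { toFun := fun x => (sqIdeal K L).mapQ (sqIdeal K L) (bracketHom K L x)
        fun y hy => (isIdeal_sqIdeal K L y hy x).2
      map_add' := fun x y => by
        ext z
        exact congrArg (Submodule.Quotient.mk (p := sqIdeal K L)) (add_bracket K x y z)
      map_smul' := fun c x => by
        ext z
        exact congrArg (Submodule.Quotient.mk (p := sqIdeal K L)) (smul_bracket c x z) }
    fun x hx => by
      rw [LinearMap.mem_ker]
      ext y
      exact (Submodule.Quotient.mk_eq_zero _).2 (isIdeal_sqIdeal K L x hx y).1

/-- The associated Lie algebra `L / I`; its bracket is induced by that of `L`. -/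
instance quotientLieRing : LieRing (L ⧸ sqIdeal K L) where
  bracket a b := quotientBracket K L a b
  add_lie a b c := by simp
  lie_add a b c := by simp
  lie_self a := by
    obtain ⟨x, rfl⟩ := Submodule.Quotient.mk_surjective _ a
    exact (Submodule.Quotient.mk_eq_zero _).2 (sq_mem_sqIdeal K L x)
  leibniz_lie a b c := by
    obtain ⟨x, rfl⟩ := Submodule.Quotient.mk_surjective _ a
    obtain ⟨y, rfl⟩ := Submodule.Quotient.mk_surjective _ b
    obtain ⟨z, rfl⟩ := Submodule.Quotient.mk_surjective _ c
    change Submodule.Quotient.mk ⁅x, ⁅y, z⁆⁆ = (Submodule.Quotient.mk ⁅⁅x, y⁆, z⁆ +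
      Submodule.Quotient.mk ⁅y, ⁅x, z⁆⁆ : L ⧸ sqIdeal K L)
    rw [← Submodule.Quotient.mk_add, Submodule.Quotient.eq, leibniz K x y z]
    have h := sq_mem_sqIdeal K L (⁅x, z⁆ + y)
    rw [add_bracket K, bracket_add K, bracket_add K] at h
    have h2 := (sqIdeal K L).sub_mem ((sqIdeal K L).sub_mem h (sq_mem_sqIdeal K L ⁅x, z⁆))
      (sq_mem_sqIdeal K L y)
    convert (sqIdeal K L).neg_mem h2 using 1
    abel

instance quotientLieAlgebra : LieAlgebra K (L ⧸ sqIdeal K L) where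
  lie_smul c a b := (quotientBracket K L a).map_smul c b

@[simp] theorem quotient_bracket_mk (x y : L) :
    ⁅(Submodule.Quotient.mk x : L ⧸ sqIdeal K L), (Submodule.Quotient.mk y : L ⧸ sqIdeal K L)⁆ =
      Submodule.Quotient.mk ⁅x, y⁆ := rfl

/-- The right action of the associated Lie algebra `L / I` on `I`, `i · (x + I) = [i, x]`. -/
def sqAction : sqIdeal K L →ₗ[K] (L ⧸ sqIdeal K L) →ₗ[K] sqIdeal K L where
  toFun i := (sqIdeal K L).liftQ
    (((bracketHom K L i).codRestrict (sqIdeal K L)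
      fun x => (isIdeal_sqIdeal K L i i.2 x).1))
    fun y hy => by
      rw [LinearMap.mem_ker]
      exact Subtype.ext (bracket_eq_zero_of_mem K L (i : L) hy)
  map_add' i j := by
    apply LinearMap.ext
    intro a
    obtain ⟨x, rfl⟩ := Submodule.Quotient.mk_surjective _ a
    exact Subtype.ext (add_bracket K (i : L) (j : L) x)
  map_smul' c i := by
    apply LinearMap.ext
    intro a
    obtain ⟨x, rfl⟩ := Submodule.Quotient.mk_surjective _ a
    exact Subtype.ext (smul_bracket c (i : L) x)

@[simp] theorem coe_sqAction_mk (i : sqIdeal K L) (x : L) :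
    (sqAction K L i (Submodule.Quotient.mk x) : L) = ⁅(i : L), x⁆ := rfl

end Quotient

section RightModule

variable {K G M : Type*} [Field K] [LieRing G] [LieAlgebra K G] [AddCommGroup M] [Module K M]

/-- A bilinear map `ρ : M × G → M` makes `M` a right module over the Lie algebra `G`. -/
def IsRightModule (ρ : M →ₗ[K] G →ₗ[K] M) : Prop :=
  ∀ (i : M) (x y : G), ρ i ⁅x, y⁆ = ρ (ρ i x) y - ρ (ρ i y) x

/-- Submodules of a right module. -/
def IsRightSubmodule (ρ : M →ₗ[K] G →ₗ[K] M) (W : Submodule K M) : Prop :=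
  ∀ w ∈ W, ∀ g : G, ρ w g ∈ W

/-- Irreducible submodules: nonzero, with no submodules other than zero and themselves. -/
def IsIrreducibleSubmodule (ρ : M →ₗ[K] G →ₗ[K] M) (W : Submodule K M) : Prop :=
  IsRightSubmodule ρ W ∧ W ≠ ⊥ ∧
    ∀ V : Submodule K M, V ≤ W → IsRightSubmodule ρ V → V = ⊥ ∨ V = W

/-- Restriction of a right action along a homomorphism of Lie algebras. -/
def restrictAction {H : Type*} [LieRing H] [LieAlgebra K H] (ρ : M →ₗ[K] G →ₗ[K] M)
    (f : H →ₗ⁅K⁆ G) : M →ₗ[K] H →ₗ[K] M :=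
  ρ.compl₂ (f : H →ₗ[K] G)

theorem IsRightModule.restrictAction {H : Type*} [LieRing H] [LieAlgebra K H]
    {ρ : M →ₗ[K] G →ₗ[K] M} (hρ : IsRightModule ρ) (f : H →ₗ⁅K⁆ G) :
    IsRightModule (restrictAction ρ f) := by
  intro i x y
  simp [LeibnizAlgebra.restrictAction, hρ i (f x) (f y)]

/-- The algebra `G + M` of a right `G`-module `M`: the vector space `G × M` with bracket
`[g + i, g' + i'] = [g, g'] + i · g'`. -/
def SemidirectSum (_ρ : M →ₗ[K] G →ₗ[K] M) : Type _ := G × M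

instance (ρ : M →ₗ[K] G →ₗ[K] M) : AddCommGroup (SemidirectSum ρ) :=
  inferInstanceAs (AddCommGroup (G × M))

instance (ρ : M →ₗ[K] G →ₗ[K] M) : Module K (SemidirectSum ρ) :=
  inferInstanceAs (Module K (G × M))

instance (ρ : M →ₗ[K] G →ₗ[K] M) : Bracket (SemidirectSum ρ) (SemidirectSum ρ) where
  bracket a b := ((⁅a.1, b.1⁆, ρ a.2 b.1) : G × M)

theorem IsRightModule.leibnizAlgebra {ρ : M →ₗ[K] G →ₗ[K] M} (hρ : IsRightModule ρ) :
    LeibnizAlgebra K (SemidirectSum ρ) where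
  add_bracket x y z := Prod.ext (add_lie x.1 y.1 z.1) (by
    change ρ (x.2 + y.2) z.1 = ρ x.2 z.1 + ρ y.2 z.1; simp)
  bracket_add x y z := Prod.ext (lie_add x.1 y.1 z.1) (map_add (ρ x.2) y.1 z.1)
  smul_bracket c x y := Prod.ext (smul_lie c x.1 y.1) (by
    change ρ (c • x.2) y.1 = c • ρ x.2 y.1; simp)
  bracket_smul c x y := Prod.ext (lie_smul c x.1 y.1) (map_smul (ρ x.2) c y.1)
  leibniz x y z := Prod.ext ((ofLieAlgebra K G).leibniz x.1 y.1 z.1) (hρ x.2 y.1 z.1)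

end RightModule

theorem isRightModule_sqAction (K L : Type*) [Field K] [AddCommGroup L] [Module K L]
    [Bracket L L] [LeibnizAlgebra K L] : IsRightModule (sqAction K L) := by
  intro i a b
  obtain ⟨x, rfl⟩ := Submodule.Quotient.mk_surjective _ a
  obtain ⟨y, rfl⟩ := Submodule.Quotient.mk_surjective _ b
  exact Subtype.ext (leibniz K (i : L) x y)

section Sum

/-- The direct sum `A ⊕ B` of two algebras with bracket, with componentwise operations. -/
def AlgebraSum (A B : Type*) : Type _ := A × B

variable {K A B : Type*} [Field K] [AddCommGroup A] [Module K A] [Bracket A A]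
  [AddCommGroup B] [Module K B] [Bracket B B]

instance : AddCommGroup (AlgebraSum A B) := inferInstanceAs (AddCommGroup (A × B))

instance : Module K (AlgebraSum A B) := inferInstanceAs (Module K (A × B))

instance : Bracket (AlgebraSum A B) (AlgebraSum A B) where
  bracket a b := ((⁅a.1, b.1⁆, ⁅a.2, b.2⁆) : A × B)

instance [LeibnizAlgebra K A] [LeibnizAlgebra K B] : LeibnizAlgebra K (AlgebraSum A B) where
  add_bracket x y z := Prod.ext (add_bracket K x.1 y.1 z.1) (add_bracket K x.2 y.2 z.2)
  bracket_add x y z := Prod.ext (bracket_add K x.1 y.1 z.1) (bracket_add K x.2 y.2 z.2)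
  smul_bracket c x y := Prod.ext (smul_bracket c x.1 y.1) (smul_bracket c x.2 y.2)
  bracket_smul c x y := Prod.ext (bracket_smul c x.1 y.1) (bracket_smul c x.2 y.2)
  leibniz x y z := Prod.ext (leibniz K x.1 y.1 z.1) (leibniz K x.2 y.2 z.2)

variable (K A B) in
/-- `A` and `B` are isomorphic: some linear bijection preserves brackets. -/
def Isomorphic : Prop := ∃ f : A ≃ₗ[K] B, ∀ x y : A, f ⁅x, y⁆ = ⁅f x, f y⁆

end Sum

/-- The complex Lie algebra `sl₂`. -/
abbrev Sl2 : Type := LieAlgebra.SpecialLinear.sl (Fin 2) ℂ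

section Sl2Sl2

variable {L : Type*} [AddCommGroup L] [Module ℂ L] [Bracket L L] [LeibnizAlgebra ℂ L]

/-- For `φ : L / I ≅ sl₂¹ ⊕ sl₂²`, the right action of the first summand `sl₂¹` on `I`. -/
noncomputable def action₁ (φ : (L ⧸ sqIdeal ℂ L) ≃ₗ⁅ℂ⁆ (Sl2 × Sl2)) :
    sqIdeal ℂ L →ₗ[ℂ] Sl2 →ₗ[ℂ] sqIdeal ℂ L :=
  restrictAction (sqAction ℂ L) (φ.symm.toLieHom.comp (LieHom.inl ℂ Sl2 Sl2))

/-- For `φ : L / I ≅ sl₂¹ ⊕ sl₂²`, the right action of the second summand `sl₂²` on `I`. -/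
noncomputable def action₂ (φ : (L ⧸ sqIdeal ℂ L) ≃ₗ⁅ℂ⁆ (Sl2 × Sl2)) :
    sqIdeal ℂ L →ₗ[ℂ] Sl2 →ₗ[ℂ] sqIdeal ℂ L :=
  restrictAction (sqAction ℂ L) (φ.symm.toLieHom.comp (LieHom.inr ℂ Sl2 Sl2))

end Sl2Sl2

end LeibnizAlgebra

/-! Let `n` be the common highest weight of the two `sl₂¹`-summands of `I`, and let `P` be the space
of vectors of weight `n` killed by the raising operator. Then `P` is a plane and `I = ⊕ fᵏ P` for `0
≤ k ≤ n` (`isInternal_lowering`). The action of `sl₂²` commutes with that of `sl₂¹`, so it preserves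
`P`, and each `fᵏ` embeds `P` equivariantly. A plane is irreducible or trivial over `sl₂²`. In the
first case the `fᵏ P` are the summands in (c); in the second `sl₂²` kills all of `I`
(`decomposition_or_trivial`).

In the trivial case, right multiplication by `I` is zero, so `L` is a right module over `G = sl₂¹ ⊕
sl₂²`, an extension of the adjoint module `G` by `I`. An equivariant section `σ : G → L` satisfies
`[σ a, σ b] = σ [a, b]` and yields (d). It is built one factor at a time (`exists_section`). The
second Casimir vanishes on `I` and is `8` on `sl₂²`. The first is `n(n+2)` on `I`, `8` on `sl₂¹` and
`0` on `sl₂²`, so a polynomial in it works unless `n(n+2) = 8`, that is `n = 2`. There `I` and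
`sl₂¹` have the same highest weight, and a highest weight vector of the adjoint module is lifted by
hand (`exists_highest_lift`). -/

namespace LeibnizAlgebra

open Module

/-! ### The standard basis of `sl₂` and its perfectness. -/

section StandardTriple

/-- The standard raising element of `sl₂`. -/
def Sl2.e : Sl2 := ⟨!![0, 1; 0, 0], by simp [LieAlgebra.SpecialLinear.sl, Matrix.trace_fin_two]⟩

/-- The standard lowering element of `sl₂`. -/
def Sl2.f : Sl2 := ⟨!![0, 0; 1, 0], by simp [LieAlgebra.SpecialLinear.sl, Matrix.trace_fin_two]⟩

/-- The standard semisimple element of `sl₂`. -/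
def Sl2.h : Sl2 := ⟨!![1, 0; 0, -1], by simp [LieAlgebra.SpecialLinear.sl, Matrix.trace_fin_two]⟩

theorem Sl2.lie_e_f : ⁅Sl2.e, Sl2.f⁆ = Sl2.h := by
  apply Subtype.ext
  rw [LieAlgebra.SpecialLinear.sl_bracket]
  simp [Sl2.e, Sl2.f, Sl2.h]

theorem Sl2.lie_h_e : ⁅Sl2.h, Sl2.e⁆ = (2 : ℂ) • Sl2.e := by
  apply Subtype.ext
  rw [LieAlgebra.SpecialLinear.sl_bracket]
  simp [Sl2.e, Sl2.h]
  norm_num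

theorem Sl2.lie_h_f : ⁅Sl2.h, Sl2.f⁆ = -((2 : ℂ) • Sl2.f) := by
  apply Subtype.ext
  rw [LieAlgebra.SpecialLinear.sl_bracket]
  ext i j
  fin_cases i <;> fin_cases j <;> norm_num [Sl2.f, Sl2.h, Matrix.mul_apply]

theorem Sl2.isSl2Triple : IsSl2Triple Sl2.h Sl2.e Sl2.f where
  h_ne_zero := fun H => by
    have := congrFun₂ (congrArg Subtype.val H) 0 0
    simp [Sl2.h] at this
  lie_e_f := Sl2.lie_e_f
  lie_h_e_nsmul := by rw [Sl2.lie_h_e, two_smul, two_nsmul]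
  lie_h_f_nsmul := by rw [Sl2.lie_h_f, two_smul, two_nsmul]

theorem Sl2.eq_combination (x : Sl2) :
    x = x.1 0 1 • Sl2.e + x.1 1 0 • Sl2.f + x.1 0 0 • Sl2.h := by
  have hx : x.1 1 1 = - x.1 0 0 := by
    have h2 : Matrix.trace x.1 = 0 := x.2
    rw [Matrix.trace_fin_two] at h2
    linear_combination h2
  apply Subtype.ext
  ext i j
  fin_cases i <;> fin_cases j <;> simp [Sl2.e, Sl2.f, Sl2.h, hx]

theorem Sl2.exists_combination (x : Sl2) :
    ∃ a b c : ℂ, x = a • Sl2.e + b • Sl2.f + c • Sl2.h :=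
  ⟨_, _, _, Sl2.eq_combination x⟩

/-- A linear map on `sl₂` that sends all brackets into a subspace sends everything there. -/
theorem Sl2.map_mem_of_map_lie_mem {M : Type*} [AddCommGroup M] [Module ℂ M]
    (g : Sl2 →ₗ[ℂ] M) (V : Submodule ℂ M) (hg : ∀ x y : Sl2, g ⁅x, y⁆ ∈ V) (x : Sl2) :
    g x ∈ V := by
  -- Each basis vector is a multiple of a bracket: `e = ½[h, e]`, `f = -½[h, f]`, `h = [e, f]`.
  have h1 : g Sl2.e ∈ V := by
    have := V.smul_mem (2⁻¹ : ℂ) (hg Sl2.h Sl2.e)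
    rwa [Sl2.lie_h_e, map_smul, smul_smul, inv_mul_cancel₀ two_ne_zero, one_smul] at this
  have h2 : g Sl2.f ∈ V := by
    have := V.smul_mem (-2⁻¹ : ℂ) (hg Sl2.h Sl2.f)
    rwa [Sl2.lie_h_f, map_neg, map_smul, smul_neg, neg_smul, neg_neg, smul_smul,
      inv_mul_cancel₀ two_ne_zero, one_smul] at this
  have h3 : g Sl2.h ∈ V := Sl2.lie_e_f ▸ hg Sl2.e Sl2.f
  obtain ⟨a, b, c, rfl⟩ := Sl2.exists_combination x
  simp only [map_add, map_smul]
  exact V.add_mem (V.add_mem (V.smul_mem _ h1) (V.smul_mem _ h2)) (V.smul_mem _ h3)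

end StandardTriple

/-! ### Highest weight vectors and the strings below them. -/

section Highest

variable {M : Type*} [AddCommGroup M] [Module ℂ M] [LieRingModule Sl2 M] [LieModule ℂ Sl2 M]

/-- Powers of the lowering operator. -/
noncomputable def lowering (M : Type*) [AddCommGroup M] [Module ℂ M] [LieRingModule Sl2 M]
    [LieModule ℂ Sl2 M] (k : ℕ) : M →ₗ[ℂ] M := LieModule.toEnd ℂ Sl2 M Sl2.f ^ k

/-- Vectors of weight `n` that the raising operator kills. -/
noncomputable def highestSpace (M : Type*) [AddCommGroup M] [Module ℂ M] [LieRingModule Sl2 M]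
    [LieModule ℂ Sl2 M] (n : ℕ) : Submodule ℂ M :=
  (LieModule.toEnd ℂ Sl2 M Sl2.h).eigenspace (n : ℂ) ⊓
    LinearMap.ker (LieModule.toEnd ℂ Sl2 M Sl2.e)

theorem mem_highestSpace {n : ℕ} {v : M} :
    v ∈ highestSpace M n ↔ ⁅Sl2.h, v⁆ = (n : ℂ) • v ∧ ⁅Sl2.e, v⁆ = 0 := by
  simp [highestSpace]

theorem hasPrimitiveVector_of_mem {n : ℕ} {v : M} (hv : v ∈ highestSpace M n) (h0 : v ≠ 0) :
    Sl2.isSl2Triple.HasPrimitiveVectorWith v (n : ℂ) :=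
  ⟨h0, (mem_highestSpace.1 hv).1, (mem_highestSpace.1 hv).2⟩

theorem lie_h_lowering {n : ℕ} {v : M} (hv : v ∈ highestSpace M n) (k : ℕ) :
    ⁅Sl2.h, lowering M k v⁆ = ((n : ℂ) - 2 * k) • lowering M k v := by
  by_cases h0 : v = 0
  · simp [h0]
  exact (hasPrimitiveVector_of_mem hv h0).lie_h_pow_toEnd_f k

theorem lie_f_lowering (v : M) (k : ℕ) : ⁅Sl2.f, lowering M k v⁆ = lowering M (k + 1) v := by
  simp [lowering, pow_succ']

theorem lie_e_lowering_succ {n : ℕ} {v : M} (hv : v ∈ highestSpace M n) (k : ℕ) :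
    ⁅Sl2.e, lowering M (k + 1) v⁆ = (((k : ℂ) + 1) * (n - k)) • lowering M k v := by
  by_cases h0 : v = 0
  · simp [h0]
  exact (hasPrimitiveVector_of_mem hv h0).lie_e_pow_succ_toEnd_f k

theorem lowering_eq_zero [FiniteDimensional ℂ M] {n : ℕ} {v : M} (hv : v ∈ highestSpace M n) :
    lowering M (n + 1) v = 0 := by
  by_cases h0 : v = 0
  · simp [h0]
  exact (hasPrimitiveVector_of_mem hv h0).pow_toEnd_f_eq_zero_of_eq_nat rfl

theorem lowering_ne_zero {n k : ℕ} {v : M} (hv : v ∈ highestSpace M n) (h0 : v ≠ 0)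
    (hk : k ≤ n) : lowering M k v ≠ 0 :=
  (hasPrimitiveVector_of_mem hv h0).pow_toEnd_f_ne_zero_of_eq_nat rfl hk

/-- The submodule generated by a highest weight vector. -/
noncomputable def highestSubmodule [FiniteDimensional ℂ M] (n : ℕ) (v : M)
    (hv : v ∈ highestSpace M n) : LieSubmodule ℂ Sl2 M where
  __ := Submodule.span ℂ (Set.range fun k : Fin (n + 1) => lowering M k v)
  lie_mem {x m} hm := by
    have key : ∀ k : Fin (n + 1), ⁅x, lowering M k v⁆ ∈
        Submodule.span ℂ (Set.range fun k : Fin (n + 1) => lowering M k v) := by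
      intro k
      have mem : ∀ j : ℕ, j < n + 1 → lowering M j v ∈
          Submodule.span ℂ (Set.range fun k : Fin (n + 1) => lowering M k v) :=
        fun j hj => Submodule.subset_span ⟨⟨j, hj⟩, rfl⟩
      obtain ⟨a, b, c, rfl⟩ := Sl2.exists_combination x
      simp only [add_lie, smul_lie]
      refine add_mem (add_mem ?_ ?_) ?_ <;> apply Submodule.smul_mem
      · obtain ⟨k, hk⟩ := k
        cases k with
        | zero => simp [lowering, (mem_highestSpace.1 hv).2]
        | succ j =>
          rw [lie_e_lowering_succ hv]
          exact Submodule.smul_mem _ _ (mem j (by omega))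
      · rw [lie_f_lowering]
        by_cases hk : (k : ℕ) = n
        · rw [hk, lowering_eq_zero hv]; exact zero_mem _
        · exact mem _ (by omega)
      · rw [lie_h_lowering hv]
        exact Submodule.smul_mem _ _ (mem k k.2)
    refine Submodule.span_induction (p := fun m _ => ⁅x, m⁆ ∈
      Submodule.span ℂ (Set.range fun k : Fin (n + 1) => lowering M k v)) ?_ ?_ ?_ ?_ hm
    · rintro _ ⟨k, rfl⟩; exact key k
    · simp
    · intro a b _ _ ha hb; rw [lie_add]; exact add_mem ha hb
    · intro a b _ hb; rw [lie_smul]; exact Submodule.smul_mem _ _ hb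

/-- The `k`-th image lies in the eigenspace of `h` for `n - 2k`; these eigenvalues are distinct. -/
theorem iSupIndep_lowering (n : ℕ) :
    iSupIndep fun k : Fin (n + 1) => (highestSpace M n).map (lowering M k) := by
  have h1 := (LieModule.toEnd ℂ Sl2 M Sl2.h).eigenspaces_iSupIndep
  have h2 : Function.Injective fun k : Fin (n + 1) => (n : ℂ) - 2 * ((k : ℕ) : ℂ) := by
    intro a b hab
    simpa [Fin.ext_iff] using hab
  refine (h1.comp h2).mono ?_
  rintro k _ ⟨v, hv, rfl⟩
  rw [Function.comp_apply, Module.End.mem_eigenspace_iff]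
  exact lie_h_lowering hv k

theorem lowering_injOn {n k : ℕ} (hk : k ≤ n) :
    Function.Injective ((lowering M k).domRestrict (highestSpace M n)) := by
  rw [← LinearMap.ker_eq_bot, LinearMap.ker_eq_bot']
  intro v hv
  by_contra h
  exact lowering_ne_zero v.2 (fun h' => h (Subtype.ext h')) hk hv

theorem linearIndependent_lowering {n : ℕ} {v : M} (hv : v ∈ highestSpace M n) (h0 : v ≠ 0) :
    LinearIndependent ℂ fun k : Fin (n + 1) => lowering M k v :=
  (iSupIndep_lowering (M := M) n).linearIndependent _ (fun _ => ⟨v, hv, rfl⟩)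
    fun k => lowering_ne_zero hv h0 (Nat.lt_succ_iff.1 k.2)

/-- An irreducible finite-dimensional `sl₂`-submodule is generated by a highest weight vector. -/
theorem exists_highest_of_irreducible [FiniteDimensional ℂ M] (W : LieSubmodule ℂ Sl2 M)
    (hW : W ≠ ⊥) (hirr : ∀ V : LieSubmodule ℂ Sl2 M, V ≤ W → V = ⊥ ∨ V = W) :
    ∃ n : ℕ, ∃ v ∈ highestSpace M n, v ≠ 0 ∧
      (W : Submodule ℂ M) =
        Submodule.span ℂ (Set.range fun k : Fin (n + 1) => lowering M k v) ∧
      finrank ℂ W = n + 1 := by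
  have : Nontrivial W := (LieSubmodule.nontrivial_iff_ne_bot ℂ Sl2 M).2 hW
  obtain ⟨μ, w, h0, hw⟩ := Sl2.isSl2Triple.exists_hasPrimitiveVectorWith (R := ℂ) (M := W)
  obtain ⟨n, rfl⟩ := hw.exists_nat
  have hv : (w : M) ∈ highestSpace M n :=
    mem_highestSpace.2 ⟨congrArg Subtype.val hw.lie_h, congrArg Subtype.val hw.lie_e⟩
  have h0' : (w : M) ≠ 0 := by simpa using h0
  have hmem : ∀ k, lowering M k w ∈ W := by
    intro k
    induction k with
    | zero => simp [lowering]
    | succ k ih => rw [← lie_f_lowering]; exact W.lie_mem ih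
  have hle : highestSubmodule n (w : M) hv ≤ W := by
    intro m hm
    have : Submodule.span ℂ (Set.range fun k : Fin (n + 1) => lowering M k (w : M)) ≤
        (W : Submodule ℂ M) := by
      rw [Submodule.span_le]; rintro _ ⟨k, rfl⟩; exact hmem k
    exact this hm
  have hne : highestSubmodule n (w : M) hv ≠ ⊥ := by
    intro h
    have : (w : M) ∈ highestSubmodule n (w : M) hv :=
      Submodule.subset_span ⟨0, by simp [lowering]⟩
    rw [h, LieSubmodule.mem_bot] at this
    exact h0' this
  have heq : (W : Submodule ℂ M) =
      Submodule.span ℂ (Set.range fun k : Fin (n + 1) => lowering M k (w : M)) :=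
    congrArg LieSubmodule.toSubmodule ((hirr _ hle).resolve_left hne).symm
  refine ⟨n, w, hv, h0', heq, ?_⟩
  have h3 := finrank_span_eq_card (linearIndependent_lowering hv h0')
  rw [← heq, Fintype.card_fin] at h3
  exact h3

/-- Equal dimensions force equal highest weights, so both summands are spanned by lowerings of
vectors of the same `highestSpace M n`. Its dimension comes from counting: `n + 1` isomorphic images
fill a space of dimension `2(n + 1)`. -/
theorem isInternal_lowering [FiniteDimensional ℂ M] (W₁ W₂ : LieSubmodule ℂ Sl2 M)
    (hc : IsCompl (W₁ : Submodule ℂ M) (W₂ : Submodule ℂ M))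
    (h₁ : W₁ ≠ ⊥) (hi₁ : ∀ V : LieSubmodule ℂ Sl2 M, V ≤ W₁ → V = ⊥ ∨ V = W₁)
    (h₂ : W₂ ≠ ⊥) (hi₂ : ∀ V : LieSubmodule ℂ Sl2 M, V ≤ W₂ → V = ⊥ ∨ V = W₂)
    (hd : finrank ℂ W₁ = finrank ℂ W₂) :
    ∃ n : ℕ, finrank ℂ W₁ = n + 1 ∧ finrank ℂ (highestSpace M n) = 2 ∧
      DirectSum.IsInternal fun k : Fin (n + 1) => (highestSpace M n).map (lowering M k) := by
  obtain ⟨n, v, hv, -, hWv, hn⟩ := exists_highest_of_irreducible W₁ h₁ hi₁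
  obtain ⟨n', w, hw, -, hWw, hn'⟩ := exists_highest_of_irreducible W₂ h₂ hi₂
  obtain rfl : n = n' := by omega
  have hint : DirectSum.IsInternal
      fun k : Fin (n + 1) => (highestSpace M n).map (lowering M k) := by
    rw [DirectSum.isInternal_submodule_iff_iSupIndep_and_iSup_eq_top]
    refine ⟨iSupIndep_lowering n, ?_⟩
    rw [eq_top_iff, ← hc.sup_eq_top, hWv, hWw, sup_le_iff]
    constructor <;> rw [Submodule.span_le] <;> rintro _ ⟨k, rfl⟩ <;>
      refine Submodule.mem_iSup_of_mem k ⟨_, ?_, rfl⟩ <;> assumption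
  refine ⟨n, hn, ?_, hint⟩
  have h1 := Submodule.finrank_add_eq_of_isCompl hc
  have h2 := (LinearEquiv.ofBijective (DirectSum.coeLinearMap _) hint).finrank_eq
  rw [finrank_directSum] at h2
  have h3 : ∀ k : Fin (n + 1), finrank ℂ ((highestSpace M n).map (lowering M k)) =
      finrank ℂ (highestSpace M n) := by
    intro k
    rw [← LinearMap.range_domRestrict]
    exact LinearMap.finrank_range_of_inj (lowering_injOn (Nat.lt_succ_iff.1 k.2))
  simp only [h3, Finset.sum_const, Finset.card_univ, Fintype.card_fin, smul_eq_mul] at h2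
  have h4 : finrank ℂ (W₁ : Submodule ℂ M) = n + 1 := hn
  have h5 : finrank ℂ (W₂ : Submodule ℂ M) = n + 1 := hn'
  rw [h4, h5, ← h2] at h1
  have : (n + 1) * finrank ℂ (highestSpace M n) = (n + 1) * 2 := by omega
  exact Nat.eq_of_mul_eq_mul_left (Nat.succ_pos n) this

end Highest
end LeibnizAlgebra

namespace LeibnizAlgebra

open Module

/-! ### The Casimir and `h` on weight strings. -/

section Weights

variable {M : Type*} [AddCommGroup M] [Module ℂ M] [LieRingModule Sl2 M] [LieModule ℂ Sl2 M]

theorem casimir_lowering {n : ℕ} {v : M} (hv : v ∈ highestSpace M n) (k : ℕ) :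
    ⁅Sl2.h, ⁅Sl2.h, lowering M k v⁆⁆ + (2 : ℂ) • ⁅Sl2.e, ⁅Sl2.f, lowering M k v⁆⁆ +
      (2 : ℂ) • ⁅Sl2.f, ⁅Sl2.e, lowering M k v⁆⁆ = ((n : ℂ) * (n + 2)) • lowering M k v := by
  rw [lie_f_lowering, lie_e_lowering_succ hv, lie_h_lowering hv, lie_smul, lie_h_lowering hv]
  cases k with
  | zero =>
    have : ⁅Sl2.e, lowering M 0 v⁆ = 0 := by simp [lowering, (mem_highestSpace.1 hv).2]
    rw [this, lie_zero]
    module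
  | succ k =>
    rw [lie_e_lowering_succ hv, lie_smul, lie_f_lowering]
    push_cast
    module

/-- The weights `2, 0, -2` are the roots of `t³ = 4t`. -/
theorem lie_h_cube_lowering {v : M} (hv : v ∈ highestSpace M 2) {k : ℕ} (hk : k < 3) :
    ⁅Sl2.h, ⁅Sl2.h, ⁅Sl2.h, lowering M k v⁆⁆⁆ = (4 : ℂ) • ⁅Sl2.h, lowering M k v⁆ := by
  simp only [lie_h_lowering hv, lie_smul, smul_smul]
  congr 1
  interval_cases k <;> norm_num

end Weights

/-! ### The dichotomy for the second action. -/

section RightActions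

variable {M : Type*} [AddCommGroup M] [Module ℂ M]

/-- A right module over a Lie algebra, seen as a left module. -/
abbrev IsRightModule.lieRingModule {G : Type*} [LieRing G] [LieAlgebra ℂ G]
    {ρ : M →ₗ[ℂ] G →ₗ[ℂ] M} (hρ : IsRightModule ρ) : LieRingModule G M where
  bracket x v := -ρ v x
  add_lie x y v := by simp [add_comm]
  lie_add x v w := by simp [add_comm]
  leibniz_lie x y v := by simp [hρ v x y]

theorem IsRightModule.lieModule {G : Type*} [LieRing G] [LieAlgebra ℂ G]
    {ρ : M →ₗ[ℂ] G →ₗ[ℂ] M} (hρ : IsRightModule ρ) :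
    letI := hρ.lieRingModule
    LieModule ℂ G M :=
  letI := hρ.lieRingModule
  { smul_lie := fun c x v => by change -ρ v (c • x) = c • -ρ v x; simp
    lie_smul := fun c x v => by change -ρ (c • v) x = c • -ρ v x; simp }

/-- A right `sl₂`-module structure on a plane is irreducible or trivial. -/
theorem irreducible_or_trivial_of_finrank_eq_two [FiniteDimensional ℂ M]
    {ρ : M →ₗ[ℂ] Sl2 →ₗ[ℂ] M} (hρ : IsRightModule ρ) {P : Submodule ℂ M}
    (hP : IsRightSubmodule ρ P) (h2 : finrank ℂ P = 2) :
    IsIrreducibleSubmodule ρ P ∨ ∀ p ∈ P, ∀ b, ρ p b = 0 := by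
  by_cases hirr : ∀ V : Submodule ℂ M, V ≤ P → IsRightSubmodule ρ V → V = ⊥ ∨ V = P
  · refine Or.inl ⟨hP, ?_, hirr⟩
    rintro rfl
    simp at h2
  right
  push Not at hirr
  obtain ⟨V, hVP, hV, hV0, hVne⟩ := hirr
  have hlt : finrank ℂ V < 2 := h2 ▸ Submodule.finrank_lt_finrank_of_lt (lt_of_le_of_ne hVP hVne)
  have hpos : 0 < finrank ℂ V := by
    rwa [Nat.pos_iff_ne_zero, Ne, Submodule.finrank_eq_zero]
  obtain ⟨u, hu0, hu⟩ := finrank_eq_one_iff'.1 (show finrank ℂ V = 1 by omega)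
  -- `V` is a line, on which `sl₂` acts by commuting scalars; so brackets, hence everything, act by
  -- zero.
  have hVt : ∀ v ∈ V, ∀ b, ρ v b = 0 := by
    intro v hv b
    refine (Submodule.mem_bot ℂ).1 (Sl2.map_mem_of_map_lie_mem (ρ v) ⊥ (fun x y => ?_) b)
    obtain ⟨c, hc⟩ := hu ⟨_, hV u u.2 x⟩
    obtain ⟨d, hd⟩ := hu ⟨_, hV u u.2 y⟩
    obtain ⟨a, ha⟩ := hu ⟨v, hv⟩
    have hc' : ρ (u : M) x = c • (u : M) := (congrArg Subtype.val hc).symm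
    have hd' : ρ (u : M) y = d • (u : M) := (congrArg Subtype.val hd).symm
    have ha' : v = a • (u : M) := (congrArg Subtype.val ha).symm
    rw [Submodule.mem_bot, ha', hρ]
    simp only [map_smul, LinearMap.smul_apply, hc', hd']
    module
  obtain ⟨w, hwP, hwV⟩ := SetLike.exists_of_lt (lt_of_le_of_ne hVP hVne)
  have hsup : P ≤ V ⊔ Submodule.span ℂ {w} := by
    have h1 : V < V ⊔ Submodule.span ℂ {w} := by
      refine lt_of_le_of_ne le_sup_left fun h => hwV ?_
      rw [h]
      exact Submodule.mem_sup_right (Submodule.mem_span_singleton_self w)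
    have h3 := Submodule.finrank_lt_finrank_of_lt h1
    have hle : V ⊔ Submodule.span ℂ {w} ≤ P :=
      sup_le hVP ((Submodule.span_singleton_le_iff_mem _ _).2 hwP)
    exact (Submodule.eq_of_le_of_finrank_le hle (by omega)).ge
  have hdec : ∀ p ∈ P, ∃ v ∈ V, ∃ c : ℂ, p = v + c • w := by
    intro p hp
    obtain ⟨v, hv, y, hy, rfl⟩ := Submodule.mem_sup.1 (hsup hp)
    obtain ⟨c, rfl⟩ := Submodule.mem_span_singleton.1 hy
    exact ⟨v, hv, c, rfl⟩
  -- The same argument on the line `P / V`. As `V` is killed, brackets then kill `w` itself.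
  have hwt : ∀ b, ρ w b ∈ V := by
    refine Sl2.map_mem_of_map_lie_mem (ρ w) V fun x y => ?_
    obtain ⟨v, hv, c, hc⟩ := hdec _ (hP w hwP x)
    obtain ⟨v', hv', d, hd⟩ := hdec _ (hP w hwP y)
    rw [hρ, hc, hd]
    simp only [map_add, map_smul, LinearMap.add_apply, LinearMap.smul_apply, hVt v hv,
      hVt v' hv', hc, hd]
    convert V.sub_mem (V.smul_mem c hv') (V.smul_mem d hv) using 1
    module
  have hw0 : ∀ b, ρ w b = 0 := fun b =>
    (Submodule.mem_bot ℂ).1 (Sl2.map_mem_of_map_lie_mem (ρ w) ⊥ (fun x y => by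
      rw [hρ, hVt _ (hwt x), hVt _ (hwt y), sub_zero]; exact zero_mem _) b)
  intro p hp b
  obtain ⟨v, hv, c, rfl⟩ := hdec p hp
  simp [hVt v hv, hw0]

/-- The image of an irreducible submodule under an injective equivariant map is irreducible. -/
theorem IsIrreducibleSubmodule.map {ρ : M →ₗ[ℂ] Sl2 →ₗ[ℂ] M} {P : Submodule ℂ M}
    (hP : IsIrreducibleSubmodule ρ P) (T : M →ₗ[ℂ] M) (hT : ∀ v b, T (ρ v b) = ρ (T v) b)
    (hinj : Function.Injective (T.domRestrict P)) : IsIrreducibleSubmodule ρ (P.map T) := by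
  obtain ⟨hsub, hne, hirr⟩ := hP
  refine ⟨?_, ?_, ?_⟩
  · rintro _ ⟨p, hp, rfl⟩ b
    exact ⟨ρ p b, hsub p hp b, hT p b⟩
  · intro h
    obtain ⟨p, hp, h0⟩ := Submodule.exists_mem_ne_zero_of_ne_bot hne
    have h1 : T p = 0 := by
      have : T p ∈ P.map T := ⟨p, hp, rfl⟩
      rwa [h, Submodule.mem_bot] at this
    have h2 : (⟨p, hp⟩ : P) = 0 := hinj (by simpa using h1)
    exact h0 (congrArg Subtype.val h2)
  · intro V hV hVs
    have hmap : (P ⊓ V.comap T).map T = V := by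
      apply le_antisymm
      · rintro _ ⟨p, hp, rfl⟩; exact hp.2
      · intro v hv
        obtain ⟨p, hp, rfl⟩ := hV hv
        exact ⟨p, ⟨hp, hv⟩, rfl⟩
    rcases hirr (P ⊓ V.comap T) inf_le_left (fun w hw b => ⟨hsub w hw.1 b, by
      change T (ρ w b) ∈ V; rw [hT]; exact hVs _ hw.2 b⟩) with h | h
    · left; rw [← hmap, h, Submodule.map_bot]
    · right; rw [← hmap, h]

/-- The commuting action `ρ₂` preserves the plane of highest weight vectors for `ρ₁` and commutes
with lowering, so its behaviour on that plane spreads to `M`. In the trivial case the Casimir scalar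
of `ρ₁`, and the cubic relation when `n = 2`, are kept for the splitting. -/
theorem decomposition_or_trivial [FiniteDimensional ℂ M] {ρ₁ ρ₂ : M →ₗ[ℂ] Sl2 →ₗ[ℂ] M}
    (hρ₁ : IsRightModule ρ₁) (hρ₂ : IsRightModule ρ₂)
    (hcomm : ∀ v a b, ρ₁ (ρ₂ v b) a = ρ₂ (ρ₁ v a) b) {I₁ I₂ : Submodule ℂ M}
    (hI : IsCompl I₁ I₂) (hI₁ : IsIrreducibleSubmodule ρ₁ I₁)
    (hI₂ : IsIrreducibleSubmodule ρ₁ I₂) {d : ℕ} (hd₁ : finrank ℂ I₁ = d)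
    (hd₂ : finrank ℂ I₂ = d) :
    (∃ J : Fin d → Submodule ℂ M, DirectSum.IsInternal J ∧
      ∀ k, IsIrreducibleSubmodule ρ₂ (J k)) ∨
    (∀ v b, ρ₂ v b = 0) ∧ ∃ n : ℕ,
      (∀ v, ρ₁ (ρ₁ v Sl2.h) Sl2.h + (2 : ℂ) • ρ₁ (ρ₁ v Sl2.f) Sl2.e +
        (2 : ℂ) • ρ₁ (ρ₁ v Sl2.e) Sl2.f = ((n : ℂ) * (n + 2)) • v) ∧
      (n = 2 → ∀ v, ρ₁ (ρ₁ (ρ₁ v Sl2.h) Sl2.h) Sl2.h = (4 : ℂ) • ρ₁ v Sl2.h) := by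
  let := hρ₁.lieRingModule
  have := hρ₁.lieModule
  have hlie : ∀ (x : Sl2) (v : M), ⁅x, v⁆ = -ρ₁ v x := fun _ _ => rfl
  have irr : ∀ W : Submodule ℂ M, IsIrreducibleSubmodule ρ₁ W →
      ∃ W' : LieSubmodule ℂ Sl2 M, (W' : Submodule ℂ M) = W ∧ W' ≠ ⊥ ∧
        ∀ V : LieSubmodule ℂ Sl2 M, V ≤ W' → V = ⊥ ∨ V = W' := by
    rintro W ⟨hs, hne, hi⟩
    refine ⟨{ __ := W, lie_mem := fun {x m} hm => W.neg_mem (hs m hm x) }, rfl, ?_, ?_⟩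
    · intro h
      exact hne (congrArg LieSubmodule.toSubmodule h)
    · intro V hV
      rcases hi V hV (fun w hw g => by
        have := V.toSubmodule.neg_mem (V.lie_mem (x := g) hw)
        rwa [hlie, neg_neg] at this) with h | h
      · left; rwa [← LieSubmodule.toSubmodule_eq_bot]
      · right; rwa [← LieSubmodule.toSubmodule_inj]
  obtain ⟨W₁, rfl, hne₁, hirr₁⟩ := irr I₁ hI₁
  obtain ⟨W₂, rfl, hne₂, hirr₂⟩ := irr I₂ hI₂
  obtain ⟨n, hn, h2, hint⟩ := isInternal_lowering W₁ W₂ hI hne₁ hirr₁ hne₂ hirr₂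
    (hd₁.trans hd₂.symm)
  obtain rfl : n + 1 = d := hn.symm.trans hd₁
  have hlow : ∀ k v b, lowering M k (ρ₂ v b) = ρ₂ (lowering M k v) b := by
    intro k v b
    induction k with
    | zero => simp [lowering]
    | succ k ih => rw [← lie_f_lowering, ih, ← lie_f_lowering, hlie, hlie, hcomm]; simp
  have hsub : IsRightSubmodule ρ₂ (highestSpace M n) := by
    intro v hv b
    have hv' := mem_highestSpace.1 hv
    rw [hlie, hlie, neg_eq_iff_eq_neg] at hv'
    refine mem_highestSpace.2 ⟨?_, ?_⟩
    · rw [hlie, hcomm, hv'.1]; simp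
    · rw [hlie, hcomm, neg_eq_zero.1 hv'.2]; simp
  have htop := ((DirectSum.isInternal_submodule_iff_iSupIndep_and_iSup_eq_top _).1 hint).2
  have hind : ∀ T : M →ₗ[ℂ] M, (∀ k < n + 1, ∀ p ∈ highestSpace M n, T (lowering M k p) = 0) →
      ∀ v, T v = 0 := by
    intro T hT v
    have : (⊤ : Submodule ℂ M) ≤ LinearMap.ker T := by
      rw [← htop, iSup_le_iff]
      rintro k _ ⟨p, hp, rfl⟩
      exact hT k k.2 p hp
    exact this Submodule.mem_top
  rcases irreducible_or_trivial_of_finrank_eq_two hρ₂ hsub h2 with h | h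
  · left
    exact ⟨_, hint, fun k => h.map _ (hlow k) (lowering_injOn (Nat.lt_succ_iff.1 k.2))⟩
  right
  refine ⟨fun v b => hind (ρ₂.flip b) (fun k _ p hp => ?_) v, n, fun v => ?_, ?_⟩
  · rw [LinearMap.flip_apply, ← hlow, h p hp, map_zero]
  · have := hind (ρ₁.flip Sl2.h ∘ₗ ρ₁.flip Sl2.h + (2 : ℂ) • ρ₁.flip Sl2.e ∘ₗ ρ₁.flip Sl2.f +
      (2 : ℂ) • ρ₁.flip Sl2.f ∘ₗ ρ₁.flip Sl2.e - ((n : ℂ) * (n + 2)) • LinearMap.id)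
      (fun k _ p hp => by
        have := casimir_lowering hp k
        -- The left action is minus the right one; the Casimir is quadratic, so the signs cancel.
        simp only [hlie, map_neg, LinearMap.neg_apply, neg_neg] at this
        simp [this]) v
    simpa [sub_eq_zero] using this
  · rintro rfl v
    have := hind (ρ₁.flip Sl2.h ∘ₗ ρ₁.flip Sl2.h ∘ₗ ρ₁.flip Sl2.h - (4 : ℂ) • ρ₁.flip Sl2.h)
      (fun k hk p hp => by
        have := lie_h_cube_lowering hp hk
        simp only [hlie, map_neg, LinearMap.neg_apply, neg_neg, smul_neg, neg_inj] at this
        simp [this]) v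
    simpa [sub_eq_zero] using this

end RightActions
end LeibnizAlgebra

namespace LeibnizAlgebra

open Module

/-! ### The Casimir operator of a right module. -/

section Casimir

theorem Sl2.lie_f_e : ⁅Sl2.f, Sl2.e⁆ = -Sl2.h := by rw [← lie_skew, Sl2.lie_e_f]

theorem Sl2.lie_e_h : ⁅Sl2.e, Sl2.h⁆ = -((2 : ℂ) • Sl2.e) := by rw [← lie_skew, Sl2.lie_h_e]

theorem Sl2.lie_f_h : ⁅Sl2.f, Sl2.h⁆ = (2 : ℂ) • Sl2.f := by
  rw [← lie_skew, Sl2.lie_h_f, neg_neg]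

/-- The adjoint module has highest weight `2`, and `2(2 + 2) = 8`. -/
theorem Sl2.casimir_adjoint (b : Sl2) :
    ⁅⁅b, Sl2.h⁆, Sl2.h⁆ + (2 : ℂ) • ⁅⁅b, Sl2.f⁆, Sl2.e⁆ + (2 : ℂ) • ⁅⁅b, Sl2.e⁆, Sl2.f⁆ =
      (8 : ℂ) • b := by
  obtain ⟨x, y, z, rfl⟩ := Sl2.exists_combination b
  simp only [add_lie, smul_lie, neg_lie, lie_self, zero_lie, Sl2.lie_e_f, Sl2.lie_f_e,
    Sl2.lie_e_h, Sl2.lie_h_e, Sl2.lie_f_h, Sl2.lie_h_f]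
  module

variable {M : Type*} [AddCommGroup M] [Module ℂ M]

/-- The Casimir operator of a right `sl₂`-module. -/
noncomputable def casimir (ρ : M →ₗ[ℂ] Sl2 →ₗ[ℂ] M) : M →ₗ[ℂ] M :=
  ρ.flip Sl2.h ∘ₗ ρ.flip Sl2.h + (2 : ℂ) • ρ.flip Sl2.e ∘ₗ ρ.flip Sl2.f +
    (2 : ℂ) • ρ.flip Sl2.f ∘ₗ ρ.flip Sl2.e

theorem casimir_apply (ρ : M →ₗ[ℂ] Sl2 →ₗ[ℂ] M) (v : M) :
    casimir ρ v = ρ (ρ v Sl2.h) Sl2.h + (2 : ℂ) • ρ (ρ v Sl2.f) Sl2.e +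
      (2 : ℂ) • ρ (ρ v Sl2.e) Sl2.f := rfl

theorem casimir_equivariant {ρ : M →ₗ[ℂ] Sl2 →ₗ[ℂ] M} (hρ : IsRightModule ρ) (v : M)
    (x : Sl2) : casimir ρ (ρ v x) = ρ (casimir ρ v) x := by
  -- Three rewriting rules bring iterated actions to a normal order: `e` first, then `f`, then `h`.
  have h1 : ∀ v, ρ (ρ v Sl2.f) Sl2.e = ρ (ρ v Sl2.e) Sl2.f - ρ v Sl2.h := fun v => by
    rw [← Sl2.lie_e_f, hρ]; abel
  have h2 : ∀ v, ρ (ρ v Sl2.h) Sl2.e = ρ (ρ v Sl2.e) Sl2.h + (2 : ℂ) • ρ v Sl2.e := fun v => by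
    rw [← map_smul, ← Sl2.lie_h_e, hρ]; abel
  have h3 : ∀ v, ρ (ρ v Sl2.h) Sl2.f = ρ (ρ v Sl2.f) Sl2.h - (2 : ℂ) • ρ v Sl2.f := fun v => by
    rw [← map_smul, ← neg_neg ((2 : ℂ) • Sl2.f), ← Sl2.lie_h_f, map_neg, hρ]; abel
  obtain ⟨a, b, c, rfl⟩ := Sl2.exists_combination x
  simp only [casimir_apply, map_add, map_sub, map_smul, LinearMap.add_apply, LinearMap.sub_apply,
    LinearMap.smul_apply, h1, h2, h3]
  module

theorem casimir_comm {G : Type*} [AddCommGroup G] [Module ℂ G] (ρ : M →ₗ[ℂ] Sl2 →ₗ[ℂ] M)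
    (ρ' : M →ₗ[ℂ] G →ₗ[ℂ] M) (hc : ∀ v a b, ρ (ρ' v b) a = ρ' (ρ v a) b) (v : M) (x : G) :
    casimir ρ (ρ' v x) = ρ' (casimir ρ v) x := by
  simp only [casimir_apply, hc, map_add, map_smul, LinearMap.add_apply, LinearMap.smul_apply]

end Casimir

/-! ### Lifting a highest weight vector of weight `2`. -/

section Lifting

variable {V : Type*} [AddCommGroup V] [Module ℂ V]

/-- In an extension of a module generated by a vector of weight `2` by a module on which `h` is
semisimple with weights `-2, 0, 2`, the generator lifts to a highest weight vector. -/
theorem exists_highest_lift (N : Submodule ℂ V) (H E F : V →ₗ[ℂ] V)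
    (hE : ∀ v ∈ N, E v ∈ N) (hF : ∀ v ∈ N, F v ∈ N) (hH : ∀ v ∈ N, H v ∈ N)
    (hEF : ∀ v, E (F v) = F (E v) + H v) (hHE : ∀ v, H (E v) = E (H v) + (2 : ℂ) • E v)
    (hHF : ∀ v, H (F v) = F (H v) - (2 : ℂ) • F v)
    (hcube : ∀ v ∈ N, H (H (H v)) = (4 : ℂ) • H v) {v : V}
    (hv : H v - (2 : ℂ) • v ∈ N) (hvE : E v ∈ N) (hvF : F (F (F v)) ∈ N) :
    ∃ w, w - v ∈ N ∧ H w = (2 : ℂ) • w ∧ E w = 0 ∧ F (F (F w)) = 0 := by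
  -- The polynomial `t(t+2)/8` is `1` at `2` and vanishes at `0` and `-2`. The error `u = (H - 2) w`
  -- is `(H³ - 4H) v / 8`, so `H - 2` kills it. It remains to show `u = 0`.
  set w : V := (8⁻¹ : ℂ) • (H (H v) + (2 : ℂ) • H v) with hw
  set u : V := H w - (2 : ℂ) • w with hu
  have hwv : w - v ∈ N := by
    have := N.smul_mem (8⁻¹ : ℂ) (N.add_mem (hH _ hv) (N.smul_mem (4 : ℂ) hv))
    convert this using 1
    rw [hw, map_sub, map_smul]
    module
  have hHw : H w = u + (2 : ℂ) • w := by rw [hu]; abel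
  have huN : u ∈ N := by
    convert N.add_mem (N.sub_mem (hH _ hwv) (N.smul_mem (2 : ℂ) hwv)) hv using 1
    rw [hu, map_sub]
    module
  have hHu : H u = (2 : ℂ) • u := by
    have h := hcube _ hv
    simp only [map_sub, map_smul] at h
    simp only [hu, hw, map_sub, map_smul, map_add]
    linear_combination (norm := module) (8⁻¹ : ℂ) • h
  -- The only eigenvalues of `H` on `N` are `0` and `±2`; below, weights `±4` are excluded.
  have vanish : ∀ x ∈ N, ∀ c : ℂ, H x = c • x → c * (c ^ 2 - 4) ≠ 0 → x = 0 := by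
    intro x hx c hc h0
    have := hcube x hx
    simp only [hc, map_smul] at this
    have h2 : (c * (c ^ 2 - 4)) • x = 0 := by
      rw [← sub_eq_zero] at this
      rw [← this]
      module
    exact (smul_eq_zero.1 h2).resolve_left h0
  have hEwN : E w ∈ N := by
    convert N.add_mem (hE _ hwv) hvE using 1
    rw [map_sub]; abel
  have hEu : E u = 0 := by
    refine vanish _ (hE _ huN) 4 ?_ (by norm_num)
    rw [hHE, hHu, map_smul]
    module
  have hEw : E w = 0 := by
    refine vanish _ hEwN 4 ?_ (by norm_num)
    rw [hHE, hHw, map_add, hEu, map_smul]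
    module
  have hFFFw : F (F (F w)) ∈ N := by
    convert N.add_mem (hF _ (hF _ (hF _ hwv))) hvF using 1
    simp only [map_sub]; abel
  have hF3u : F (F (F u)) = 0 := by
    refine vanish _ (hF _ (hF _ (hF _ huN))) (-4) ?_ (by norm_num)
    simp only [hHF, hHu, map_sub, map_smul]
    module
  have hF3w : F (F (F w)) = 0 := by
    refine vanish _ hFFFw (-4) ?_ (by norm_num)
    simp only [hHF, hHw, map_sub, map_smul, map_add, hF3u]
    module
  have hF2u : F (F u) = 0 := by
    -- For highest weight `λ` one has `E F³ w = 3(λ - 2) F² w`; here `H w = 2w + u` leaves `3 F² u`.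
    have h : E (F (F (F w))) = (3 : ℂ) • F (F u) := by
      simp only [hEF, hHF, hHw, map_sub, map_smul, map_add, hEw, map_zero]
      module
    rw [hF3w, map_zero, eq_comm] at h
    exact (smul_eq_zero.1 h).resolve_left (by norm_num)
  have hu0 : u = 0 := by
    have h : E (E (F (F u))) = (4 : ℂ) • u := by
      simp only [hEF, hHF, hHu, map_sub, map_smul, map_add, hEu, map_zero]
      module
    rw [hF2u, map_zero, map_zero, eq_comm] at h
    exact (smul_eq_zero.1 h).resolve_left (by norm_num)
  exact ⟨w, hwv, by rw [hHw, hu0, zero_add], hEw, hF3w⟩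

end Lifting

/-! ### Equivariant sections of extensions of the adjoint module. -/

section Splitting

variable {V : Type*} [AddCommGroup V] [Module ℂ V]

/-- An equivariant endomorphism that vanishes on the kernel of an equivariant surjection
descends to the image. -/
theorem exists_descent {G : Type*} [LieRing G] [LieAlgebra ℂ G] {R : V →ₗ[ℂ] G →ₗ[ℂ] V}
    {π : V →ₗ[ℂ] G} (hπ : Function.Surjective π) (hπR : ∀ v a, π (R v a) = ⁅π v, a⁆)
    (T : V →ₗ[ℂ] V) (hT : ∀ v a, T (R v a) = R (T v) a) (hker : ∀ v, π v = 0 → T v = 0) :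
    ∃ τ : G →ₗ[ℂ] V, (∀ v, τ (π v) = T v) ∧ ∀ a b, R (τ a) b = τ ⁅a, b⁆ := by
  obtain ⟨s, hs⟩ := π.exists_rightInverse_of_surjective (LinearMap.range_eq_top.2 hπ)
  have hs' : ∀ a, π (s a) = a := fun a => LinearMap.congr_fun hs a
  have key : ∀ v, T (s (π v)) = T v := fun v => by
    rw [← sub_eq_zero, ← map_sub]
    exact hker _ (by rw [map_sub, hs', sub_self])
  refine ⟨T ∘ₗ s, key, fun a b => ?_⟩
  rw [LinearMap.comp_apply, LinearMap.comp_apply, ← hT, ← key, hπR, hs']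

/-- This serves the case `n = 2`, where the Casimir cannot separate `sl₂¹` from the kernel. A lift
`w` of `f` generates a copy of the adjoint module. -/
theorem exists_first_section {R : V →ₗ[ℂ] (Sl2 × Sl2) →ₗ[ℂ] V} (hR : IsRightModule R)
    {π : V →ₗ[ℂ] Sl2 × Sl2} (hπ : Function.Surjective π)
    (hπR : ∀ v a, π (R v a) = ⁅π v, a⁆) (htriv : ∀ v, π v = 0 → ∀ b, R v (0, b) = 0)
    (hcube : ∀ v, π v = 0 →
      R (R (R v (Sl2.h, 0)) (Sl2.h, 0)) (Sl2.h, 0) = (4 : ℂ) • R v (Sl2.h, 0)) :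
    ∃ τ : Sl2 × Sl2 →ₗ[ℂ] V, (∀ a, π (τ a) = (a.1, 0)) ∧ ∀ a b, R (τ a) b = τ ⁅a, b⁆ := by
  have lie_inl : ∀ x y : Sl2, ⁅((x, 0) : Sl2 × Sl2), ((y, 0) : Sl2 × Sl2)⁆ = (⁅x, y⁆, 0) :=
    fun x y => Prod.ext rfl (lie_self 0)
  have lie_inr : ∀ x y : Sl2, ⁅((0, x) : Sl2 × Sl2), ((0, y) : Sl2 × Sl2)⁆ = (0, ⁅x, y⁆) :=
    fun x y => Prod.ext (lie_self 0) rfl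
  have hsmul : ∀ (c : ℂ) (x : Sl2), ((c • x, 0) : Sl2 × Sl2) = c • (x, 0) :=
    fun c x => Prod.ext rfl (smul_zero c).symm
  have hneg : ∀ (x : Sl2), ((-x, 0) : Sl2 × Sl2) = -(x, 0) :=
    fun x => Prod.ext rfl neg_zero.symm
  have hadd : ∀ (x y : Sl2), ((x + y, 0) : Sl2 × Sl2) = (x, 0) + (y, 0) :=
    fun x y => Prod.ext rfl (add_zero 0).symm
  have rel : ∀ (x y : Sl2) v, R (R v (x, 0)) (y, 0) = R (R v (y, 0)) (x, 0) + R v (⁅x, y⁆, 0) :=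
    fun x y v => by rw [← lie_inl, hR]; abel
  have hst : ∀ x, ∀ v ∈ LinearMap.ker π, R v x ∈ LinearMap.ker π := fun x v hv => by
    rw [LinearMap.mem_ker] at hv ⊢; rw [hπR, hv, zero_lie]
  obtain ⟨v, hv⟩ := hπ (Sl2.f, 0)
  -- Under a right action `f` raises and `e` lowers, since `[f, h] = 2f`; their roles are exchanged.
  obtain ⟨w, hwv, hHw, hEw, hFw⟩ := exists_highest_lift (LinearMap.ker π)
    (R.flip (Sl2.h, 0)) (R.flip (Sl2.f, 0)) (R.flip (Sl2.e, 0)) (hst _) (hst _) (hst _)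
    (fun v => by simp only [LinearMap.flip_apply]; rw [rel, Sl2.lie_e_f])
    (fun v => by simp only [LinearMap.flip_apply]; rw [rel, Sl2.lie_f_h, hsmul, map_smul])
    (fun v => by
      simp only [LinearMap.flip_apply]
      rw [rel, Sl2.lie_e_h, hneg, map_neg, hsmul, map_smul, sub_eq_add_neg])
    (fun v hv => hcube v hv)
    (v := v)
    (by simp [hπR, hv, lie_inl, Sl2.lie_f_h])
    (by simp [hπR, hv])
    (by simp [hπR, hv, lie_inl, Sl2.lie_f_e, Sl2.lie_h_e])
  rw [LinearMap.mem_ker, map_sub, sub_eq_zero, hv] at hwv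
  simp only [LinearMap.flip_apply] at hHw hEw hFw
  -- The second factor sends `x` into the kernel, which it kills; so its brackets, hence all of it,
  -- kill `x`.
  have hsnd : ∀ x : V, (π x).2 = 0 → ∀ b, R x (0, b) = 0 := by
    intro x hx b
    refine (Submodule.mem_bot ℂ).1 (Sl2.map_mem_of_map_lie_mem
      ((R x).comp (LinearMap.inr ℂ Sl2 Sl2)) ⊥ (fun y z => ?_) b)
    have h0 : ∀ y, π (R x (0, y)) = 0 := fun y => by
      rw [hπR]
      exact Prod.ext (lie_zero _) (by change ⁅(π x).2, y⁆ = 0; rw [hx, zero_lie])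
    rw [Submodule.mem_bot, LinearMap.comp_apply, LinearMap.inr_apply, ← lie_inr, hR,
      htriv _ (h0 y), htriv _ (h0 z), sub_zero]
  set w₁ := R w (Sl2.e, 0) with hw₁
  set w₂ := R w₁ (Sl2.e, 0) with hw₂
  have hHw₁ : R w₁ (Sl2.h, 0) = 0 := by
    rw [hw₁, rel, hHw, Sl2.lie_e_h, hneg, hsmul, map_neg, map_smul]
    simp only [map_smul, LinearMap.smul_apply]
    module
  have hHw₂ : R w₂ (Sl2.h, 0) = (-2 : ℂ) • w₂ := by
    rw [hw₂, rel, hHw₁, Sl2.lie_e_h, hneg, hsmul, map_neg, map_smul]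
    simp only [map_zero, LinearMap.zero_apply]
    module
  have hEw₁ : R w₁ (Sl2.f, 0) = (2 : ℂ) • w := by
    rw [hw₁, rel, hEw, Sl2.lie_e_f, hHw]
    simp
  have hEw₂ : R w₂ (Sl2.f, 0) = (2 : ℂ) • w₁ := by
    rw [hw₂, rel, hEw₁, Sl2.lie_e_f, hHw₁]
    simp [hw₁]
  have hπ₁ : π w₁ = (-Sl2.h, 0) := by
    rw [hw₁, hπR, hwv, lie_inl, Sl2.lie_f_e]
  have hπ₂ : π w₂ = ((-2 : ℂ) • Sl2.e, 0) := by
    rw [hw₂, hπR, hπ₁, lie_inl, neg_lie, Sl2.lie_h_e, neg_smul]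
  let c : Fin 2 → Fin 2 → Sl2 →ₗ[ℂ] ℂ := fun i j =>
    { toFun := fun a => a.1 i j, map_add' := fun _ _ => rfl, map_smul' := fun _ _ => rfl }
  have hc : ∀ i j a, c i j a = a.1 i j := fun _ _ _ => rfl
  -- The coefficients invert `π w = f`, `π w₁ = -h`, `π w₂ = -2e`.
  let τ : Sl2 →ₗ[ℂ] V := (c 0 1).smulRight ((-2⁻¹ : ℂ) • w₂) + (c 0 0).smulRight (-w₁) +
    (c 1 0).smulRight w
  have τe : τ Sl2.e = (-2⁻¹ : ℂ) • w₂ := by simp [τ, hc, Sl2.e]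
  have τf : τ Sl2.f = w := by simp [τ, hc, Sl2.f]
  have τh : τ Sl2.h = -w₁ := by simp [τ, hc, Sl2.h]
  have hπτ : ∀ a, π (τ a) = (a, 0) := by
    intro a
    obtain ⟨x, y, z, rfl⟩ := Sl2.exists_combination a
    simp only [map_add, map_smul, τe, τf, τh, map_neg, hwv, hπ₁, hπ₂]
    ext1
    · simp
    · simp
  refine ⟨τ ∘ₗ LinearMap.fst ℂ Sl2 Sl2, fun a => hπτ a.1, ?_⟩
  rintro ⟨a, a'⟩ ⟨b, b'⟩
  have hsplit : ((b, b') : Sl2 × Sl2) = (b, 0) + (0, b') := by simp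
  have hfst : (⁅((a, a') : Sl2 × Sl2), ((b, b') : Sl2 × Sl2)⁆).1 = ⁅a, b⁆ := rfl
  simp only [LinearMap.comp_apply, LinearMap.fst_apply, hfst]
  rw [hsplit, map_add, hsnd _ (by rw [hπτ]) b', add_zero]
  obtain ⟨x, y, z, rfl⟩ := Sl2.exists_combination a
  obtain ⟨p, q, r, rfl⟩ := Sl2.exists_combination b
  simp only [map_add, map_smul, τe, τf, τh, add_lie, lie_add, smul_lie, lie_smul, lie_self,
    Sl2.lie_e_f, Sl2.lie_f_e, Sl2.lie_e_h, Sl2.lie_h_e, Sl2.lie_f_h, Sl2.lie_h_f, map_neg,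
    hadd, hsmul, LinearMap.add_apply, LinearMap.smul_apply, LinearMap.neg_apply, hHw, hEw, hFw,
    hHw₁, hHw₂, hEw₁, hEw₂, ← hw₁, ← hw₂, map_zero]
  module

/-- Polynomials in the Casimirs are equivariant; those that kill the kernel descend to `sl₂ × sl₂`,
and are scaled to give the projection onto one factor. -/
theorem exists_section {R : V →ₗ[ℂ] (Sl2 × Sl2) →ₗ[ℂ] V} (hR : IsRightModule R)
    {π : V →ₗ[ℂ] Sl2 × Sl2} (hπ : Function.Surjective π)
    (hπR : ∀ v a, π (R v a) = ⁅π v, a⁆) (htriv : ∀ v, π v = 0 → ∀ b, R v (0, b) = 0)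
    {n : ℕ} (hcas : ∀ v, π v = 0 → casimir (restrictAction R (LieHom.inl ℂ Sl2 Sl2)) v =
      ((n : ℂ) * (n + 2)) • v)
    (hcube : n = 2 → ∀ v, π v = 0 →
      R (R (R v (Sl2.h, 0)) (Sl2.h, 0)) (Sl2.h, 0) = (4 : ℂ) • R v (Sl2.h, 0)) :
    ∃ σ : Sl2 × Sl2 →ₗ[ℂ] V, (∀ a, π (σ a) = a) ∧ ∀ a b, R (σ a) b = σ ⁅a, b⁆ := by
  set ρ₁ := restrictAction R (LieHom.inl ℂ Sl2 Sl2) with hρ₁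
  set ρ₂ := restrictAction R (LieHom.inr ℂ Sl2 Sl2) with hρ₂
  have m₁ : IsRightModule ρ₁ := hR.restrictAction _
  have m₂ : IsRightModule ρ₂ := hR.restrictAction _
  have e₁ : ∀ v a, ρ₁ v a = R v (a, 0) := fun _ _ => rfl
  have e₂ : ∀ v a, ρ₂ v a = R v (0, a) := fun _ _ => rfl
  have hc : ∀ v a b, ρ₁ (ρ₂ v b) a = ρ₂ (ρ₁ v a) b := by
    intro v a b
    have h := hR v (a, 0) (0, b)
    have h0 : ⁅((a, 0) : Sl2 × Sl2), ((0, b) : Sl2 × Sl2)⁆ = 0 :=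
      Prod.ext (lie_zero a) (zero_lie b)
    rw [h0, map_zero, eq_comm, sub_eq_zero] at h
    exact h.symm
  have hc' : ∀ v a b, ρ₂ (ρ₁ v b) a = ρ₁ (ρ₂ v a) b := fun v a b => (hc v b a).symm
  have hRsplit : ∀ v x, R v x = ρ₁ v x.1 + ρ₂ v x.2 := fun v x => by
    rw [e₁, e₂, ← map_add]; simp
  have c₁ : ∀ v x, casimir ρ₁ (R v x) = R (casimir ρ₁ v) x := fun v x => by
    rw [hRsplit, hRsplit, map_add, casimir_equivariant m₁, casimir_comm ρ₁ ρ₂ hc]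
  have c₂ : ∀ v x, casimir ρ₂ (R v x) = R (casimir ρ₂ v) x := fun v x => by
    rw [hRsplit, hRsplit, map_add, casimir_equivariant m₂,
      casimir_comm ρ₂ ρ₁ hc']
  have lie_inl : ∀ (g : Sl2 × Sl2) (x : Sl2), ⁅g, ((x, 0) : Sl2 × Sl2)⁆ = (⁅g.1, x⁆, 0) :=
    fun g x => Prod.ext rfl (lie_zero g.2)
  have lie_inr : ∀ (g : Sl2 × Sl2) (x : Sl2), ⁅g, ((0, x) : Sl2 × Sl2)⁆ = (0, ⁅g.2, x⁆) :=
    fun g x => Prod.ext (lie_zero g.1) rfl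
  have π₁ : ∀ v, π (casimir ρ₁ v) = ((8 : ℂ) • (π v).1, 0) := fun v => by
    simp only [casimir_apply, e₁, map_add, map_smul, hπR, lie_inl, Prod.smul_mk, Prod.mk_add_mk,
      smul_zero, add_zero, Sl2.casimir_adjoint]
  have π₂ : ∀ v, π (casimir ρ₂ v) = (0, (8 : ℂ) • (π v).2) := fun v => by
    simp only [casimir_apply, e₂, map_add, map_smul, hπR, lie_inr, Prod.smul_mk, Prod.mk_add_mk,
      smul_zero, add_zero, Sl2.casimir_adjoint]
  obtain ⟨τ₁, hτ₁, hτ₁R⟩ : ∃ τ : Sl2 × Sl2 →ₗ[ℂ] V,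
      (∀ a, π (τ a) = (a.1, 0)) ∧ ∀ a b, R (τ a) b = τ ⁅a, b⁆ := by
    by_cases hn : n = 2
    · exact exists_first_section hR hπ hπR htriv (hcube hn)
    set μ : ℂ := (n : ℂ) * (n + 2) with hμ
    have hμ8 : 8 - μ ≠ 0 := by
      have h1 : (2 : ℂ) - n ≠ 0 := by
        exact sub_ne_zero.2 fun h => hn (by exact_mod_cast h.symm)
      have h2 : (4 : ℂ) + n ≠ 0 := by exact_mod_cast (by omega : 4 + n ≠ 0)
      have h3 : 8 - μ = (2 - n) * (4 + n) := by rw [hμ]; ring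
      rw [h3]
      exact mul_ne_zero h1 h2
    obtain ⟨τ, hτ, hτR⟩ := exists_descent hπ hπR
      -- The factor `C - μ` kills the kernel, and `C` kills the second summand of the quotient; on
      -- the first, where `C = 8`, the product is `8(8 - μ)`.
      ((8 * (8 - μ))⁻¹ • casimir ρ₁ ∘ₗ (casimir ρ₁ - μ • LinearMap.id))
      (fun v a => by simp [c₁])
      (fun v hv => by simp [hcas v hv])
    refine ⟨τ, fun a => ?_, hτR⟩
    obtain ⟨v, rfl⟩ := hπ a
    rw [hτ]
    have h64 : (8 : ℂ) • (8 : ℂ) • (π v).1 - μ • (8 : ℂ) • (π v).1 =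
        (8 * (8 - μ)) • (π v).1 := by module
    simp only [LinearMap.smul_apply, LinearMap.comp_apply, map_smul, π₁, LinearMap.sub_apply,
      LinearMap.id_apply, map_sub, Prod.smul_mk, smul_zero, Prod.mk_sub_mk, sub_self, h64]
    rw [inv_smul_smul₀ (mul_ne_zero (by norm_num) hμ8)]
  obtain ⟨τ₂, hτ₂, hτ₂R⟩ := exists_descent hπ hπR ((8⁻¹ : ℂ) • casimir ρ₂)
    (fun v a => by simp [c₂])
    (fun v hv => by simp [casimir_apply, e₂, htriv v hv])
  refine ⟨τ₁ + τ₂, fun a => ?_, fun a b => ?_⟩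
  · obtain ⟨v, rfl⟩ := hπ a
    rw [LinearMap.add_apply, map_add, hτ₁, hτ₂, LinearMap.smul_apply, map_smul, π₂]
    ext1 <;> simp
  · simp [hτ₁R, hτ₂R]

end Splitting
end LeibnizAlgebra

namespace LeibnizAlgebra

/-! ### `L` as a right module over `L / I`. -/

section Extension

variable (K L : Type*) [Field K] [AddCommGroup L] [Module K L] [Bracket L L] [LeibnizAlgebra K L]

/-- The right action of the associated Lie algebra `L / I` on `L`. -/
def rightAction : L →ₗ[K] (L ⧸ sqIdeal K L) →ₗ[K] L where
  toFun x := (sqIdeal K L).liftQ (bracketHom K L x) fun _ hy => bracket_eq_zero_of_mem K L x hy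
  map_add' x y := by
    ext z
    exact add_bracket K x y z
  map_smul' c x := by
    ext z
    exact smul_bracket c x z

theorem rightAction_mk (x y : L) :
    rightAction K L x (Submodule.Quotient.mk y) = ⁅x, y⁆ := rfl

theorem isRightModule_rightAction : IsRightModule (rightAction K L) := by
  intro i a b
  obtain ⟨x, rfl⟩ := Submodule.Quotient.mk_surjective _ a
  obtain ⟨y, rfl⟩ := Submodule.Quotient.mk_surjective _ b
  exact leibniz K i x y

theorem mk_rightAction (x : L) (a : L ⧸ sqIdeal K L) :
    (Submodule.Quotient.mk (rightAction K L x a) : L ⧸ sqIdeal K L) =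
      ⁅(Submodule.Quotient.mk x : L ⧸ sqIdeal K L), a⁆ := by
  obtain ⟨y, rfl⟩ := Submodule.Quotient.mk_surjective _ a
  rfl

theorem coe_sqAction (i : sqIdeal K L) (a : L ⧸ sqIdeal K L) :
    (sqAction K L i a : L) = rightAction K L i a := by
  obtain ⟨y, rfl⟩ := Submodule.Quotient.mk_surjective _ a
  rfl

end Extension

end LeibnizAlgebra

/-! ### The theorem. -/

open LeibnizAlgebra in
theorem theorem4p3 {L : Type*} [AddCommGroup L] [Module ℂ L] [FiniteDimensional ℂ L]
    [Bracket L L] [LeibnizAlgebra ℂ L]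
    (φ : (L ⧸ LeibnizAlgebra.sqIdeal ℂ L) ≃ₗ⁅ℂ⁆ (LeibnizAlgebra.Sl2 × LeibnizAlgebra.Sl2))
    (I₁ I₂ : Submodule ℂ (LeibnizAlgebra.sqIdeal ℂ L))
    (hI : IsCompl I₁ I₂)
    (hI₁ : LeibnizAlgebra.IsIrreducibleSubmodule (LeibnizAlgebra.action₁ φ) I₁)
    (hI₂ : LeibnizAlgebra.IsIrreducibleSubmodule (LeibnizAlgebra.action₁ φ) I₂)
    (hdim : Module.finrank ℂ I₁ = Module.finrank ℂ I₂) :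
    (∃ J : Fin (Module.finrank ℂ I₁) → Submodule ℂ (LeibnizAlgebra.sqIdeal ℂ L),
      DirectSum.IsInternal J ∧
        ∀ k, LeibnizAlgebra.IsIrreducibleSubmodule (LeibnizAlgebra.action₂ φ) (J k)) ∨
    LeibnizAlgebra.Isomorphic ℂ L
      (LeibnizAlgebra.AlgebraSum
        (LeibnizAlgebra.SemidirectSum (LeibnizAlgebra.action₁ φ)) LeibnizAlgebra.Sl2) := by
  have hm := isRightModule_sqAction ℂ L
  have hcomm : ∀ v a b, action₁ φ (action₂ φ v b) a = action₂ φ (action₁ φ v a) b := by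
    intro v a b
    have h := hm v (φ.symm (a, 0)) (φ.symm (0, b))
    have h0 : ⁅((a, 0) : Sl2 × Sl2), ((0, b) : Sl2 × Sl2)⁆ = 0 :=
      Prod.ext (lie_zero a) (zero_lie b)
    rw [← LieEquiv.map_lie, h0, map_zero, map_zero, eq_comm, sub_eq_zero] at h
    exact h.symm
  rcases decomposition_or_trivial (hm.restrictAction _) (hm.restrictAction _) hcomm hI hI₁ hI₂ rfl
    hdim.symm with h | ⟨htriv, n, hcas, hcube⟩
  · exact Or.inl h
  right
  let π : L →ₗ[ℂ] Sl2 × Sl2 := (φ : (L ⧸ sqIdeal ℂ L) →ₗ[ℂ] Sl2 × Sl2) ∘ₗ (sqIdeal ℂ L).mkQ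
  have hπ : ∀ x, π x = φ (Submodule.Quotient.mk x) := fun _ => rfl
  have hπ0 : ∀ x, π x = 0 ↔ x ∈ sqIdeal ℂ L := fun x => by
    rw [hπ, ← Submodule.Quotient.mk_eq_zero]
    exact map_eq_zero_iff φ φ.injective
  let R : L →ₗ[ℂ] (Sl2 × Sl2) →ₗ[ℂ] L :=
    restrictAction (rightAction ℂ L) φ.symm.toLieHom
  have hRφ : ∀ x a, R x a = rightAction ℂ L x (φ.symm a) := fun _ _ => rfl
  have hR : IsRightModule R := (isRightModule_rightAction ℂ L).restrictAction _
  have hRπ : ∀ x y, R x (π y) = ⁅x, y⁆ := fun x y => by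
    rw [hRφ, hπ, LieEquiv.symm_apply_apply, rightAction_mk]
  have hπR : ∀ x a, π (R x a) = ⁅π x, a⁆ := fun x a => by
    rw [hRφ, hπ, mk_rightAction, LieEquiv.map_lie, LieEquiv.apply_symm_apply, hπ]
  have hR₁ : ∀ (i : sqIdeal ℂ L) a, R i (a, 0) = action₁ φ i a := fun i a =>
    (coe_sqAction ℂ L i _).symm
  have hR₂ : ∀ (i : sqIdeal ℂ L) b, R i (0, b) = 0 := fun i b => by
    have h : (action₂ φ i b : L) = R i (0, b) := coe_sqAction ℂ L i _
    rw [← h]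
    exact congrArg Subtype.val (htriv i b)
  obtain ⟨σ, hσ, hσR⟩ := exists_section (n := n) hR
    (π := π) (φ.surjective.comp (Submodule.Quotient.mk_surjective _)) hπR
    (fun v hv b => hR₂ ⟨v, (hπ0 v).1 hv⟩ b)
    (fun v hv => by
      have := congrArg Subtype.val (hcas ⟨v, (hπ0 v).1 hv⟩)
      simpa [coe_sqAction, restrictAction, casimir_apply, R] using this)
    (fun hn v hv => by
      have := congrArg Subtype.val (hcube hn ⟨v, (hπ0 v).1 hv⟩)
      simpa [coe_sqAction, restrictAction, R] using this)
  let Ψ : AlgebraSum (SemidirectSum (action₁ φ)) Sl2 →ₗ[ℂ] L :=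
    { toFun := fun t => σ (t.1.1, t.2) + (t.1.2 : L)
      map_add' := fun s t => by
        change σ ((s.1.1, s.2) + (t.1.1, t.2)) + ((s.1.2 : L) + t.1.2) = _
        rw [map_add]; abel
      map_smul' := fun c t => by
        change σ (c • (t.1.1, t.2)) + c • (t.1.2 : L) = c • (σ (t.1.1, t.2) + (t.1.2 : L))
        rw [map_smul, smul_add] }
  have hΨ : ∀ t, Ψ t = σ (t.1.1, t.2) + (t.1.2 : L) := fun _ => rfl
  have hπΨ : ∀ t, π (Ψ t) = (t.1.1, t.2) := fun t => by
    rw [hΨ, map_add, hσ, (hπ0 _).2 t.1.2.2, add_zero]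
  have hbij : Function.Bijective Ψ := by
    constructor
    · intro s t hst
      have h1 : (s.1.1, s.2) = (t.1.1, t.2) := by rw [← hπΨ, ← hπΨ, hst]
      rw [hΨ, hΨ, h1] at hst
      exact Prod.ext (Prod.ext (Prod.mk.inj h1).1 (Subtype.ext (add_left_cancel hst)))
        (Prod.mk.inj h1).2
    · intro x
      exact ⟨((((π x).1, ⟨x - σ (π x), (hπ0 _).1 (by rw [map_sub, hσ, sub_self])⟩) :
        Sl2 × sqIdeal ℂ L), (π x).2), add_sub_cancel _ _⟩
  -- A bracket depends on its right argument only through `π`, so equivariance of `σ` handles the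
  -- `σ` part, and on `I` only the first factor acts.
  have hlie : ∀ s t, Ψ ⁅s, t⁆ = ⁅Ψ s, Ψ t⁆ := by
    intro s t
    have hsplit : ((t.1.1, t.2) : Sl2 × Sl2) = (t.1.1, 0) + (0, t.2) := by simp
    rw [← hRπ, hπΨ, hΨ s, map_add, LinearMap.add_apply, hσR]
    nth_rewrite 2 [hsplit]
    rw [map_add, hR₁, hR₂, add_zero]
    rfl
  let e := LinearEquiv.ofBijective Ψ hbij
  refine ⟨e.symm, fun x y => e.injective ?_⟩
  rw [LinearEquiv.apply_symm_apply]
  change ⁅x, y⁆ = Ψ ⁅e.symm x, e.symm y⁆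
  rw [hlie]
  change ⁅x, y⁆ = ⁅e (e.symm x), e (e.symm y)⁆
  rw [LinearEquiv.apply_symm_apply, LinearEquiv.apply_symm_apply]
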